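/- **Collapse of polynomial higher-order logic to second-order logic.** Structures are finite (non-empty) relational structures $\mathbf A$ over a relational vocabulary $L$. A second-order relation type is an arity $r\ge 1$, and its relations over $\mathbf A$ are the sets of $r$-tuples of elements of $\mathrm{dom}(\mathbf A)$. For $j\ge 3$, a $j$-th order relation type is a tuple $\tau=(\rho_1,\dots,\rho_w)$, $w\ge 1$, of $(j-1)$-th order relation types, and its relations over $\mathbf A$ are the sets of tuples $(R_1,\dots,R_w)$ with $R_k$ a relation of type $\rho_k$ over $\mathbf A$. For $d\ge 1$ and $j\ge 3$, a $j$-th order relation $\mathcal R$ over $\mathbf A$ is *downward polynomially bounded by $d$* if $|\mathcal R|\le|\mathrm{dom}(\mathbf A)|^d$ and all relations of order at least $3$ that are nested in $\mathcal R$, at any depth, also have at most $|\mathrm{dom}(\mathbf A)|^d$ tuples. For $i\ge 3$, the formulae of $\mathrm{HO}^{i,P}$ (polynomial $i$-th order logic) over $L$ are built from - the atomic formulae $x=y$ and $R(x_1,\dots,x_n)$ for relation symbols $R$ of $L$, $X(x_1,\dots,x_r)$ for second-order variables $X$ of arity $r$, and $\mathcal X(\mathcal Y_1,\dots,\mathcal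 Y_w)$ for $j$-th order variables $\mathcal X$ of type $(\rho_1,\dots,\rho_w)$, $3\le j\le i$, and $(j-1)$-th order variables $\mathcal Y_k$ of type $\rho_k$, by Boolean connectives, quantification over elements and over second-order variables (with the usual semantics), and quantifiers $\exists^{j,P,d}\mathcal X^{j,d,\tau}$ for $3\le j\le i$ and $d\ge 1$, where $\mathbf A\models\exists^{j,P,d}\mathcal X^{j,d,\tau}\varphi$ if and only if $\varphi$ holds in $\mathbf A$ for some relation $\mathcal R$ of type $\tau$ over $\mathbf A$, as the value of $\mathcal X$, that is downward polynomially bounded by $d$. Formulae of $\mathrm{HO}^{i,P}$ may have free first-order variables but no free relation variables of any order. $\mathrm{SO}$ (second-order logic) consists of those formulae of this kind in which all relation variables are second-order. **Theorem.** For every $i\ge 3$, $\mathrm{HO}^{i,P}$ collapses to $\mathrm{SO}$: for every formula $\varphi$ of $\mathrm{HO}^{i,P}$ over $L$ there is a formula $\psi$ of $\mathrm{SO}$ over $L$, with the same free first-order variables as $\varphi$, such that $\varphi$ and $\psi$ are equivalent, that is, they are satisfied by the same valuations in every finite $L$-structure. -/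

import Mathlib

namespace HigherOrder

/-- `RelType j` is the type of `j`-th order relation types, `j ≥ 2` (there are none for `j < 2`).
A second order relation type is an arity `r ≥ 1`; a relation type of order `j + 1 ≥ 3` is a
`w`-tuple (`w ≥ 1`) of relation types of order `j`. -/
inductive RelType : ℕ → Type
  | so (r : ℕ) (hr : 1 ≤ r) : RelType 2
  | ho {j : ℕ} (w : ℕ) (hw : 1 ≤ w) (ρ : Fin w → RelType j) : RelType (j + 1)

/-- The relations of a given type over the domain `A`: sets of `r`-tuples of elements for an arity
`r`, and sets of tuples of relations of types `ρ 0, …, ρ (w - 1)` for the type `(ρ 0, …, ρ (w - 1))`. -/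
def HORel (A : Type*) : {j : ℕ} → RelType j → Type _
  | _, .so r _ => Set (Fin r → A)
  | _, .ho w _ ρ => Set ((k : Fin w) → HORel A (ρ k))

/-- A relation of order at least three is downward polynomially bounded by `d` if it has at most
`|A| ^ d` tuples and all relations of order at least three nested in it (at any depth) have at most
`|A| ^ d` tuples. There is no condition on second order relations. -/
def DownwardBounded (A : Type*) (d : ℕ) : {j : ℕ} → (τ : RelType j) → HORel A τ → Prop
  | _, .so _ _, _ => True
  | _, .ho w _ ρ, R =>
      let S : Set ((k : Fin w) → HORel A (ρ k)) := R
      S.encard ≤ ((Nat.card A ^ d : ℕ) : ℕ∞) ∧ ∀ T ∈ S, ∀ k, DownwardBounded A d (ρ k) (T k)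

/-- Relation variables of a given type: countably many second order variables of each arity, and,
for each relation type of order at least three and each degree `d ≥ 1`, countably many variables of
this type and degree. -/
inductive Var : {j : ℕ} → RelType j → Type
  | so {r : ℕ} {hr : 1 ≤ r} (n : ℕ) : Var (.so r hr)
  | ho {j w : ℕ} {hw : 1 ≤ w} {ρ : Fin w → RelType j} (d : ℕ) (hd : 1 ≤ d) (n : ℕ) :
      Var (.ho w hw ρ)

/-- A relation variable together with its order and its type. -/
structure RelVar where
  {order : ℕ}
  {type : RelType order}
  var : Var type

/-- The values over which the quantifier on a relation variable ranges: all relations for a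
second order variable, and the relations that are downward polynomially bounded by `d` for a
variable of order at least three and degree `d`. -/
def Var.InRange (A : Type*) : {j : ℕ} → {τ : RelType j} → Var τ → HORel A τ → Prop
  | _, _, .so _, _ => True
  | _, _, .ho d _ _, R => DownwardBounded A d _ R

/-- Formulae of all orders over a vocabulary `L`; first order variables are natural numbers, and
the quantifiers on variables of order at least three are the polynomially bounded ones. The
remaining connectives and the universal quantifiers are the usual abbreviations. -/
inductive Formula (L : FirstOrder.Language) : Type _
  | eq (x y : ℕ) : Formula L
  | rel {n : ℕ} (R : L.Relations n) (x : Fin n → ℕ) : Formula L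
  | soAtom {r : ℕ} {hr : 1 ≤ r} (X : Var (.so r hr)) (x : Fin r → ℕ) : Formula L
  | hoAtom {j w : ℕ} {hw : 1 ≤ w} {ρ : Fin w → RelType j} (X : Var (.ho w hw ρ))
      (Y : (k : Fin w) → Var (ρ k)) : Formula L
  | neg (φ : Formula L) : Formula L
  | and (φ ψ : Formula L) : Formula L
  | exElem (x : ℕ) (φ : Formula L) : Formula L
  | exRel {j : ℕ} {τ : RelType j} (X : Var τ) (φ : Formula L) : Formula L

namespace Formula

/-- All relation variables occurring in the formula have order at most `i`. -/
def OrderLE {L : FirstOrder.Language} (i : ℕ) : Formula L → Prop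
  | eq _ _ => True
  | rel _ _ => True
  | soAtom _ _ => 2 ≤ i
  | hoAtom (j := j) _ _ => j + 1 ≤ i
  | neg φ => OrderLE i φ
  | and φ ψ => OrderLE i φ ∧ OrderLE i ψ
  | exElem _ φ => OrderLE i φ
  | exRel (j := j) _ φ => j ≤ i ∧ OrderLE i φ

/-- The free first order variables. -/
def freeVars {L : FirstOrder.Language} : Formula L → Set ℕ
  | eq x y => {x, y}
  | rel _ x => Set.range x
  | soAtom _ x => Set.range x
  | hoAtom _ _ => ∅
  | neg φ => freeVars φ
  | and φ ψ => freeVars φ ∪ freeVars ψ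
  | exElem x φ => freeVars φ \ {x}
  | exRel _ φ => freeVars φ

/-- The free relation variables, of any order. -/
def freeRelVars {L : FirstOrder.Language} : Formula L → Set RelVar
  | eq _ _ => ∅
  | rel _ _ => ∅
  | soAtom X _ => {⟨X⟩}
  | hoAtom X Y => insert ⟨X⟩ (Set.range fun k => (⟨Y k⟩ : RelVar))
  | neg φ => freeRelVars φ
  | and φ ψ => freeRelVars φ ∪ freeRelVars ψ
  | exElem _ φ => freeRelVars φ
  | exRel X φ => freeRelVars φ \ {⟨X⟩}

open Classical in
/-- Satisfaction of a formula in the structure `A` under the valuation given by `v` on first order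
variables and by `ν` on relation variables. -/
def Sat {L : FirstOrder.Language} (A : Type*) [L.Structure A] :
    Formula L → (ℕ → A) → ((X : RelVar) → HORel A X.type) → Prop
  | eq x y, v, _ => v x = v y
  | rel R x, v, _ => FirstOrder.Language.Structure.RelMap R fun k => v (x k)
  | soAtom (r := r) X x, v, ν => (fun k => v (x k)) ∈ (show Set (Fin r → A) from ν ⟨X⟩)
  | hoAtom (w := w) (ρ := ρ) X Y, _, ν =>
      (fun k => ν ⟨Y k⟩) ∈ (show Set ((k : Fin w) → HORel A (ρ k)) from ν ⟨X⟩)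
  | neg φ, v, ν => ¬ Sat A φ v ν
  | and φ ψ, v, ν => Sat A φ v ν ∧ Sat A ψ v ν
  | exElem x φ, v, ν => ∃ a : A, Sat A φ (Function.update v x a) ν
  | exRel (τ := τ) X φ, v, ν =>
      ∃ R : HORel A τ, X.InRange A R ∧ Sat A φ v (Function.update ν ⟨X⟩ R)

/-- The formulae of polynomial `i`-th order logic: all relation variables have order at most `i`,
and none of them is free. -/
def IsHOP {L : FirstOrder.Language} (i : ℕ) (φ : Formula L) : Prop :=
  φ.OrderLE i ∧ φ.freeRelVars = ∅

/-- The formulae of second order logic: all relation variables are second order variables, and none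
of them is free. -/
def IsSO {L : FirstOrder.Language} (φ : Formula L) : Prop :=
  φ.OrderLE 2 ∧ φ.freeRelVars = ∅

end Formula

end HigherOrder

/-! A relation with at most |A|^d tuples can have its tuples indexed by d-tuples of elements. Doing
this at every level of nesting turns a downward bounded relation into finitely many second-order
relations, one per node of the tree of its type. The relation at a node takes as arguments the
indices chosen along the path to it, followed by one more index or, at a leaf, by the tuple itself.

Every code decodes to a bounded relation (`Code.downwardBounded_decode`) and every bounded relation
has a code (`Code.exists_decode_eq`), so bounded quantifiers become quantifiers over codes with no
well-formedness condition. Codes are not unique, so membership needs a second-order definition of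
"these codes decode to the same relation", obtained by recursion on the type
(`SODefinable.decode_eq`). Induction on the formula then gives `Formula.soDefinable_decode`.

A code is formally an infinite family of relations. Working with definable properties rather than
explicit formulae hides this: a formula has only finitely many free variables, and only those need
quantifiers. -/

theorem List.map_congr_of_lt {α : Type*} {v v' : ℕ → α} {m : ℕ} {xs : List ℕ}
    (hxs : ∀ x ∈ xs, x < m) (h : ∀ x < m, v' x = v x) : xs.map v' = xs.map v :=
  List.map_congr_left fun x hx => h x (hxs x hx)

namespace HigherOrder

theorem RelType.two_le {j : ℕ} (τ : RelType j) : 2 ≤ j := by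
  induction τ with
  | so r hr => exact le_rfl
  | ho w hw ρ ih => exact (ih ⟨0, hw⟩).trans (Nat.le_succ _)

/-! ### Free variables and finite blocks of quantifiers. -/

namespace Formula

variable {L : FirstOrder.Language}

theorem finite_freeVars (φ : Formula L) : φ.freeVars.Finite := by
  induction φ with
  | eq x y => exact Set.toFinite {x, y}
  | rel R x => exact Set.finite_range x
  | soAtom X x => exact Set.finite_range x
  | hoAtom X Y => exact Set.finite_empty
  | neg φ ih => exact ih
  | and φ ψ ih₁ ih₂ => exact ih₁.union ih₂
  | exElem x φ ih => exact ih.sdiff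
  | exRel X φ ih => exact ih

theorem finite_freeRelVars (φ : Formula L) : φ.freeRelVars.Finite := by
  induction φ with
  | eq x y => exact Set.finite_empty
  | rel R x => exact Set.finite_empty
  | soAtom X x => exact Set.finite_singleton _
  | hoAtom X Y => exact (Set.finite_range _).insert _
  | neg φ ih => exact ih
  | and φ ψ ih₁ ih₂ => exact ih₁.union ih₂
  | exElem x φ ih => exact ih
  | exRel X φ ih => exact ih.sdiff

/-- Satisfaction depends only on the values of the free variables. -/
theorem sat_congr {A : Type*} [L.Structure A] (φ : Formula L) {v v' : ℕ → A}
    {ν ν' : (X : RelVar) → HORel A X.type} (hv : ∀ x ∈ φ.freeVars, v x = v' x)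
    (hν : ∀ X ∈ φ.freeRelVars, ν X = ν' X) : φ.Sat A v ν ↔ φ.Sat A v' ν' := by
  induction φ generalizing v v' ν ν' with
  | eq x y =>
    simp only [Sat]
    rw [hv x (by simp [freeVars]), hv y (by simp [freeVars])]
  | rel R x =>
    simp only [Sat]
    rw [show (fun k => v (x k)) = fun k => v' (x k) from
      funext fun k => hv _ (Set.mem_range_self k)]
  | soAtom X x =>
    simp only [Sat]
    rw [show (fun k => v (x k)) = fun k => v' (x k) from
      funext fun k => hv _ (Set.mem_range_self k), hν ⟨X⟩ rfl]
  | hoAtom X Y =>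
    simp only [Sat]
    rw [show (fun k => ν ⟨Y k⟩) = fun k => ν' ⟨Y k⟩ from
      funext fun k => hν ⟨Y k⟩ (Or.inr (Set.mem_range_self k)), hν ⟨X⟩ (Or.inl rfl)]
  | neg φ ih => exact not_congr (ih hv hν)
  | and φ ψ ih₁ ih₂ =>
    exact and_congr (ih₁ (fun x h => hv x (Or.inl h)) fun X h => hν X (Or.inl h))
      (ih₂ (fun x h => hv x (Or.inr h)) fun X h => hν X (Or.inr h))
  | exElem x φ ih =>
    refine exists_congr fun a => ih (fun y hy => ?_) hν
    by_cases hxy : y = x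
    · subst hxy; simp
    · simpa [hxy] using hv y ⟨hy, hxy⟩
  | exRel X φ ih =>
    refine exists_congr fun R => and_congr_right fun _ => ih hv fun Y hY => ?_
    by_cases hXY : Y = ⟨X⟩
    · subst hXY; simp
    · simpa [hXY] using hν Y ⟨hY, hXY⟩

theorem order_le_of_mem_freeRelVars {φ : Formula L} {i : ℕ} (h : φ.OrderLE i) {X : RelVar}
    (hX : X ∈ φ.freeRelVars) : X.order ≤ i := by
  induction φ with
  | eq x y => exact hX.elim
  | rel R x => exact hX.elim
  | soAtom Y x => cases hX; exact h
  | hoAtom Y Z =>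
    rcases hX with rfl | ⟨k, rfl⟩
    · exact h
    · exact (Nat.le_succ _).trans h
  | neg φ ih => exact ih h hX
  | and φ ψ ih₁ ih₂ => exact hX.elim (ih₁ h.1) (ih₂ h.2)
  | exElem x φ ih => exact ih h hX
  | exRel Y φ ih => exact ih h.2 hX.1

/-- Existential quantification over finitely many elements. -/
theorem exists_exElems (ψ : Formula L) {S : Set ℕ} (hS : S.Finite) :
    ∃ χ : Formula L, χ.freeVars = ψ.freeVars \ S ∧ χ.freeRelVars = ψ.freeRelVars ∧
      (∀ i, ψ.OrderLE i → χ.OrderLE i) ∧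
      ∀ (A : Type*) [L.Structure A] (v : ℕ → A) (ν : (X : RelVar) → HORel A X.type),
        χ.Sat A v ν ↔ ∃ v', (∀ x ∉ S, v' x = v x) ∧ ψ.Sat A v' ν := by
  induction S, hS using Set.Finite.induction_on with
  | empty =>
    refine ⟨ψ, by simp, rfl, fun _ h => h, fun A _ v ν => ⟨fun h => ⟨v, fun _ _ => rfl, h⟩, ?_⟩⟩
    rintro ⟨v', hv', h⟩
    rwa [← funext fun x => hv' x (Set.notMem_empty x)]
  | @insert x S hx _ ih =>
    obtain ⟨χ, hfv, hfr, ho, hs⟩ := ih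
    refine ⟨.exElem x χ, ?_, hfr, ho, fun A _ v ν => ?_⟩
    · rw [freeVars, hfv, Set.sdiff_sdiff, Set.union_singleton]
    · simp only [Sat, hs]
      constructor
      · rintro ⟨a, v', hv', h⟩
        refine ⟨v', fun y hy => ?_, h⟩
        rw [Set.mem_insert_iff, not_or] at hy
        rw [hv' y hy.2, Function.update_of_ne hy.1]
      · rintro ⟨v', hv', h⟩
        refine ⟨v' x, v', fun y hy => ?_, h⟩
        by_cases hyx : y = x
        · subst hyx; simp
        · rw [Function.update_of_ne hyx]
          exact hv' y (by simp [hyx, hy])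

open Classical in
/-- Existential quantification over finitely many second order variables. -/
theorem exists_exRels (ψ : Formula L) {S : Set RelVar} (hS : S.Finite)
    (hS₂ : ∀ X ∈ S, X.order ≤ 2) :
    ∃ χ : Formula L, χ.freeVars = ψ.freeVars ∧ χ.freeRelVars = ψ.freeRelVars \ S ∧
      (ψ.OrderLE 2 → χ.OrderLE 2) ∧
      ∀ (A : Type*) [L.Structure A] (v : ℕ → A) (ν : (X : RelVar) → HORel A X.type),
        χ.Sat A v ν ↔ ∃ ν', (∀ X ∉ S, ν' X = ν X) ∧ ψ.Sat A v ν' := by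
  induction S, hS using Set.Finite.induction_on with
  | empty =>
    refine ⟨ψ, rfl, by simp, fun h => h, fun A _ v ν => ⟨fun h => ⟨ν, fun _ _ => rfl, h⟩, ?_⟩⟩
    rintro ⟨ν', hν', h⟩
    rwa [← funext fun X => hν' X (Set.notMem_empty X)]
  | @insert X S hX _ ih =>
    obtain ⟨χ, hfv, hfr, ho, hs⟩ := ih fun Y hY => hS₂ Y (Or.inr hY)
    have hX₂ := hS₂ X (Or.inl rfl)
    refine ⟨.exRel X.var χ, hfv, ?_, fun h => ⟨hX₂, ho h⟩, fun A _ v ν => ?_⟩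
    · rw [freeRelVars, hfr, Set.sdiff_sdiff, Set.union_singleton]
    · have hr : ∀ R : HORel A X.type, X.var.InRange A R := by
        intro R
        obtain ⟨X⟩ := X
        cases X with
        | so n => trivial
        | @ho j w hw ρ d hd n =>
          exact absurd ((ρ ⟨0, hw⟩).two_le) (by simp only at hX₂; omega)
      simp only [Sat, hs]
      constructor
      · rintro ⟨R, -, ν', hν', h⟩
        refine ⟨ν', fun Y hY => ?_, h⟩
        rw [Set.mem_insert_iff, not_or] at hY
        rw [hν' Y hY.2, Function.update_of_ne hY.1]
      · rintro ⟨ν', hν', h⟩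
        refine ⟨ν' X, hr _, ν', fun Y hY => ?_, h⟩
        by_cases hYX : Y = X
        · subst hYX; simp
        · rw [Function.update_of_ne hYX]
          exact hν' Y (by simp [hYX, hY])

end Formula

/-! ### Coding bounded relations by second-order relations. -/

/-- Codes of relations of any order: a relation on `A`, of no fixed arity, for every node of the
tree of the relation type, where nodes are given by the paths that lead to them. -/
abbrev Code (A : Type*) := List ℕ → List A → Prop

/-- The code of the relations of the type at the node `q` that belong to the parameters `u`. -/
def Code.sub {A : Type*} (c : Code A) (q : List ℕ) (u : List A) : Code A :=
  fun p l => c (q ++ p) (u ++ l)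

theorem Code.sub_sub {A : Type*} (c : Code A) (q q' : List ℕ) (u u' : List A) :
    (c.sub q u).sub q' u' = c.sub (q ++ q') (u ++ u') := by
  funext p l
  simp [Code.sub]

/-- The relation with a given code. The tuples of a relation of order at least three are indexed by
`d`-tuples of elements. -/
def Code.decode {A : Type*} (d : ℕ) : {j : ℕ} → (τ : RelType j) → Code A → HORel A τ
  | _, .so r _, c => {t : Fin r → A | c [] (List.ofFn t)}
  | _, .ho w _ ρ, c => {T : (k : Fin w) → HORel A (ρ k) |
      ∃ a : List A, a.length = d ∧ c [] a ∧ ∀ k, T k = Code.decode d (ρ k) (c.sub [k.1] a)}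

/-- Mutual inclusion, with tuples replaced by their indices. This back-and-forth form quantifies
over elements only and recurses to lower types. -/
theorem Code.decode_ho_eq_iff {A : Type*} {d d' j w : ℕ} {hw : 1 ≤ w} {ρ : Fin w → RelType j}
    {c c' : Code A} : c.decode d (.ho w hw ρ) = c'.decode d' (.ho w hw ρ) ↔
      (∀ a : List A, a.length = d → c [] a → ∃ a' : List A, a'.length = d' ∧ c' [] a' ∧
        ∀ k, (c.sub [k.1] a).decode d (ρ k) = (c'.sub [k.1] a').decode d' (ρ k)) ∧
      ∀ a : List A, a.length = d' → c' [] a → ∃ a' : List A, a'.length = d ∧ c [] a' ∧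
        ∀ k, (c'.sub [k.1] a).decode d' (ρ k) = (c.sub [k.1] a').decode d (ρ k) := by
  constructor
  · intro h
    exact ⟨fun a ha hc => (Set.ext_iff.1 h _).1 ⟨a, ha, hc, fun _ => rfl⟩,
      fun a ha hc => (Set.ext_iff.1 h _).2 ⟨a, ha, hc, fun _ => rfl⟩⟩
  · rintro ⟨h, h'⟩
    refine Set.ext fun T => ⟨?_, ?_⟩
    · rintro ⟨a, ha, hc, hT⟩
      rw [funext hT]
      exact h a ha hc
    · rintro ⟨a, ha, hc, hT⟩
      rw [funext hT]
      exact h' a ha hc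

/-- Every argument list met in decoding is non-empty because `d` and all arities are positive. This
matters because no second-order variable has arity 0. -/
theorem Code.decode_congr {A : Type*} {d : ℕ} (hd : 1 ≤ d) {j : ℕ} (τ : RelType j)
    {c c' : Code A} (h : ∀ p l, l ≠ [] → (c p l ↔ c' p l)) : c.decode d τ = c'.decode d τ := by
  induction τ generalizing c c' with
  | so r hr =>
    exact Set.ext fun t => h _ _ (by simp; omega)
  | ho w hw ρ ih =>
    refine Set.ext fun T => exists_congr fun a => and_congr_right fun ha => ?_
    have ha' : a ≠ [] := by rintro rfl; simp at ha; omega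
    refine and_congr (h _ _ ha') (forall_congr' fun k => ?_)
    rw [ih k (c := c.sub [k.1] a) (c' := c'.sub [k.1] a) fun p l _ => h _ _ (by simp [ha'])]

/-- Each set of tuples is contained in the image of the |A|^d possible indices. -/
theorem Code.downwardBounded_decode {A : Type*} [Finite A] (d : ℕ) {j : ℕ} (τ : RelType j)
    (c : Code A) : DownwardBounded A d τ (c.decode d τ) := by
  induction τ generalizing c with
  | so r hr => trivial
  | ho w hw ρ ih =>
    refine ⟨?_, ?_⟩
    · let f (a : Fin d → A) (k : Fin w) : HORel A (ρ k) :=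
        (c.sub [k.1] (List.ofFn a)).decode d (ρ k)
      have hsub : (show Set ((k : Fin w) → HORel A (ρ k)) from c.decode d (.ho w hw ρ)) ⊆
          f '' Set.univ := by
        rintro T ⟨a, rfl, -, hT⟩
        exact ⟨a.get, trivial, funext fun k => by simp [f, hT k]⟩
      refine (Set.encard_le_encard hsub).trans ((Set.encard_image_le _ _).trans ?_)
      rw [Set.encard_univ, ENat.card_eq_coe_natCard, Nat.card_fun, Nat.card_fin]
    · rintro T ⟨a, -, -, hT⟩ k
      rw [hT k]
      exact ih k _

theorem Code.exists_decode_eq {A : Type*} [Finite A] (d : ℕ) {j : ℕ} (τ : RelType j)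
    (R : HORel A τ) (hR : DownwardBounded A d τ R) : ∃ c : Code A, c.decode d τ = R := by
  induction τ with
  | so r hr =>
    refine ⟨fun _ l => ∃ t : Fin r → A, l = List.ofFn t ∧ t ∈ (show Set (Fin r → A) from R),
      Set.ext fun t => ⟨?_, fun ht => ⟨t, rfl, ht⟩⟩⟩
    rintro ⟨t', h, ht'⟩
    rwa [List.ofFn_injective h]
  | ho w hw ρ ih =>
    let S : Set ((k : Fin w) → HORel A (ρ k)) := R
    have hS : S.encard ≤ ((Nat.card A ^ d : ℕ) : ℕ∞) := hR.1
    have hSf : S.Finite := Set.finite_of_encard_le_coe hS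
    obtain ⟨g, hg⟩ : ∃ g : S → (Fin d → A), Function.Injective g := by
      have := hSf.to_subtype
      have := Fintype.ofFinite S
      have := Fintype.ofFinite (Fin d → A)
      refine (Function.Embedding.nonempty_of_card_le ?_).elim fun g => ⟨g, g.injective⟩
      rw [← Nat.card_eq_fintype_card, ← Nat.card_eq_fintype_card, Nat.card_fun, Nat.card_fin]
      rw [Set.encard, ENat.card_eq_coe_natCard] at hS
      exact_mod_cast hS
    choose c hc using fun (T : S) (k : Fin w) => ih k (T.1 k) (hR.2 T.1 T.2 k)
    -- The list must start with the index `g T` of a tuple. Below the root, the first entry of the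
    -- path selects a component of `T`, whose code judges the rest of the list. At the root the last
    -- condition is vacuous.
    refine ⟨fun p l => ∃ T : S, ∃ l', l = List.ofFn (g T) ++ l' ∧
      ∀ k : Fin w, ∀ p', p = k.1 :: p' → c T k p' l', ?_⟩
    have hsub (T : S) (k : Fin w) : Code.sub (fun p l => ∃ T : S, ∃ l', l = List.ofFn (g T) ++ l' ∧
        ∀ k : Fin w, ∀ p', p = k.1 :: p' → c T k p' l') [k.1] (List.ofFn (g T)) = c T k := by
      funext p l
      refine propext ⟨?_, fun h => ⟨T, l, rfl, fun k' p' hp => ?_⟩⟩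
      · rintro ⟨T', l', hl, h⟩
        obtain ⟨h₁, rfl⟩ := List.append_inj hl (by simp)
        obtain rfl := hg (List.ofFn_injective h₁)
        exact h k p rfl
      · simp only [List.singleton_append, List.cons.injEq, Fin.val_inj] at hp
        obtain ⟨rfl, rfl⟩ := hp
        exact h
    refine Set.ext fun T => ⟨?_, fun hT => ?_⟩
    · rintro ⟨a, ha, ⟨T', l', rfl, -⟩, hT⟩
      obtain rfl : l' = [] := by simpa using ha
      have : T = T'.1 := funext fun k => by rw [hT k, List.append_nil, hsub, hc]
      exact this ▸ T'.2
    · exact ⟨List.ofFn (g ⟨T, hT⟩), by simp, ⟨⟨T, hT⟩, [], by simp, by simp⟩, fun k => by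
        rw [hsub, hc]⟩

/-! ### Storing codes in second-order variables. -/

/-- Valuations of the relation variables. -/
abbrev RelVal (A : Type*) := (X : RelVar) → HORel A X.type

/-- The code formed by the values of the second order variables that are reserved for the code with
number `b`. -/
def RelVal.code {A : Type*} (μ : RelVal A) (b : ℕ) : Code A := fun p l =>
  ∃ (r : ℕ) (hr : 1 ≤ r) (t : Fin r → A), l = List.ofFn t ∧
    t ∈ (show Set (Fin r → A) from μ ⟨.so (hr := hr) (Nat.pair b (Encodable.encode p))⟩)

theorem RelVal.code_ofFn {A : Type*} (μ : RelVal A) (b : ℕ) (p : List ℕ) {r : ℕ} (hr : 1 ≤ r)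
    (t : Fin r → A) : μ.code b p (List.ofFn t) ↔
      t ∈ (show Set (Fin r → A) from μ ⟨.so (hr := hr) (Nat.pair b (Encodable.encode p))⟩) := by
  refine ⟨?_, fun h => ⟨r, hr, t, rfl, h⟩⟩
  rintro ⟨r', hr', t', h, ht'⟩
  have := List.ofFn_inj'.1 h
  simp only [Sigma.mk.injEq] at this
  obtain ⟨rfl, h⟩ := this
  cases h
  exact ht'

/-- The second order variables reserved for the code with number `b`. -/
def codeVars (b : ℕ) : Set RelVar :=
  {X | ∃ (r : ℕ) (hr : 1 ≤ r) (n : ℕ), X = ⟨.so (r := r) (hr := hr) (Nat.pair b n)⟩}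

theorem RelVal.code_congr {A : Type*} {μ μ' : RelVal A} {b : ℕ}
    (h : ∀ X ∈ codeVars b, μ X = μ' X) : μ.code b = μ'.code b := by
  funext p l
  refine propext (exists_congr fun r => exists_congr fun hr => exists_congr fun t =>
    and_congr_right fun _ => ?_)
  rw [h _ ⟨r, hr, _, rfl⟩]

/-- The value of a variable in a valuation where the variables reserved for any code form `c`. -/
def Code.value {A : Type*} (c : Code A) : {j : ℕ} → {τ : RelType j} → Var τ → HORel A τ
  | _, .so r _, .so n =>
      {t : Fin r → A | ∃ p, (Nat.unpair n).2 = Encodable.encode p ∧ c p (List.ofFn t)}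
  | _, .ho _ _ _, _ => (∅ : Set _)

open Classical in
/-- Any code is formed by the variables reserved for the code with number `b` after changing
their values. -/
theorem RelVal.exists_code_eq {A : Type*} (μ : RelVal A) (b : ℕ) (c : Code A) :
    ∃ μ' : RelVal A, (∀ X ∉ codeVars b, μ' X = μ X) ∧
      ∀ p l, l ≠ [] → (μ'.code b p l ↔ c p l) := by
  refine ⟨fun X => if X ∈ codeVars b then c.value X.var else μ X, fun X hX => if_neg hX,
    fun p l hl => ?_⟩
  obtain ⟨r, t, rfl⟩ : ∃ (r : ℕ) (t : Fin r → A), l = List.ofFn t :=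
    ⟨_, l.get, (List.ofFn_get l).symm⟩
  have hr : 1 ≤ r := Nat.pos_of_ne_zero fun h => hl (by subst h; simp)
  rw [RelVal.code_ofFn _ _ _ hr, if_pos ⟨r, hr, _, rfl⟩]
  change (∃ p', (Nat.unpair (Nat.pair b (Encodable.encode p))).2 = Encodable.encode p' ∧
    c p' (List.ofFn t)) ↔ _
  simp

/-- The degree of a variable, which is irrelevant for second order variables. -/
def Var.degree : {j : ℕ} → {τ : RelType j} → Var τ → ℕ
  | _, _, .so _ => 1
  | _, _, .ho d _ _ => d

theorem Var.one_le_degree {j : ℕ} {τ : RelType j} (X : Var τ) : 1 ≤ X.degree := by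
  cases X with
  | so n => exact le_rfl
  | ho d hd n => exact hd

theorem Var.inRange_iff {A : Type*} [Finite A] {j : ℕ} {τ : RelType j} (X : Var τ)
    (R : HORel A τ) : X.InRange A R ↔ DownwardBounded A X.degree τ R := by
  cases X <;> rfl

/-- The valuation where each variable has the value coded by the variables that `σ` assigns
to it. -/
def RelVal.decode {A : Type*} (μ : RelVal A) (σ : RelVar → ℕ) : RelVal A :=
  fun X => (μ.code (σ X)).decode X.var.degree X.type

-- Properties definable in second-order logic.

universe u

/-- Properties of valuations that are defined by a second order formula. -/
def SODefinable (L : FirstOrder.Language)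
    (P : (A : Type u) → [Finite A] → [L.Structure A] → (ℕ → A) → RelVal A → Prop) : Prop :=
  ∃ ψ : Formula L, ψ.OrderLE 2 ∧
    ∀ (A : Type u) [Finite A] [L.Structure A] (v : ℕ → A) (μ : RelVal A),
      ψ.Sat A v μ ↔ P A v μ

namespace SODefinable

variable {L : FirstOrder.Language}
  {P Q : (A : Type u) → [Finite A] → [L.Structure A] → (ℕ → A) → RelVal A → Prop}

theorem congr (hP : SODefinable L P)
    (h : ∀ (A : Type u) [Finite A] [L.Structure A] (v : ℕ → A) (μ : RelVal A),
      P A v μ ↔ Q A v μ) : SODefinable L Q := by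
  obtain ⟨ψ, ho, hs⟩ := hP
  exact ⟨ψ, ho, fun A _ _ v μ => (hs A v μ).trans (h A v μ)⟩

theorem not (hP : SODefinable L P) : SODefinable L fun A _ _ v μ => ¬ P A v μ := by
  obtain ⟨ψ, ho, hs⟩ := hP
  exact ⟨.neg ψ, ho, fun A _ _ v μ => not_congr (hs A v μ)⟩

theorem and (hP : SODefinable L P) (hQ : SODefinable L Q) :
    SODefinable L fun A _ _ v μ => P A v μ ∧ Q A v μ := by
  obtain ⟨ψ, ho, hs⟩ := hP
  obtain ⟨χ, ho', hs'⟩ := hQ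
  exact ⟨.and ψ χ, ⟨ho, ho'⟩, fun A _ _ v μ => and_congr (hs A v μ) (hs' A v μ)⟩

theorem imp (hP : SODefinable L P) (hQ : SODefinable L Q) :
    SODefinable L fun A _ _ v μ => P A v μ → Q A v μ :=
  (hP.and hQ.not).not.congr fun A _ _ v μ => by tauto

theorem iff (hP : SODefinable L P) (hQ : SODefinable L Q) :
    SODefinable L fun A _ _ v μ => (P A v μ ↔ Q A v μ) :=
  ((hP.imp hQ).and (hQ.imp hP)).congr fun A _ _ v μ => by tauto

protected theorem true : SODefinable L fun (_ : Type u) _ _ _ _ => True :=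
  ⟨.eq 0 0, trivial, fun A _ _ v μ => by simp [Formula.Sat]⟩

theorem forall_fin {w : ℕ}
    {P : Fin w → (A : Type u) → [Finite A] → [L.Structure A] → (ℕ → A) → RelVal A → Prop}
    (hP : ∀ k, SODefinable L (P k)) : SODefinable L fun A _ _ v μ => ∀ k, P k A v μ := by
  induction w with
  | zero => exact SODefinable.true.congr fun A _ _ v μ => by simp
  | succ w ih =>
    exact ((hP 0).and (ih fun k => hP k.succ)).congr fun A _ _ v μ =>
      (Fin.forall_fin_succ (P := fun k => P k A v μ)).symm

-- `S` may be infinite: it suffices to quantify over its members that are free in the defining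
-- formula.
open Classical in
theorem exists_elems (S : Set ℕ) (hP : SODefinable L P) :
    SODefinable L fun A _ _ v μ => ∃ v' : ℕ → A, (∀ x ∉ S, v' x = v x) ∧ P A v' μ := by
  obtain ⟨ψ, ho, hs⟩ := hP
  obtain ⟨χ, -, -, hχo, hχ⟩ := ψ.exists_exElems (ψ.finite_freeVars.inter_of_right S)
  refine ⟨χ, hχo 2 ho, fun A _ _ v μ => (hχ A v μ).trans ⟨?_, ?_⟩⟩
  · rintro ⟨v', hv', h⟩
    exact ⟨v', fun x hx => hv' x fun h => hx h.1, (hs A v' μ).1 h⟩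
  · rintro ⟨v', hv', h⟩
    refine ⟨fun x => if x ∈ S ∩ ψ.freeVars then v' x else v x, fun x hx => if_neg hx,
      (ψ.sat_congr (fun x hx => ?_) fun _ _ => rfl).2 ((hs A v' μ).2 h)⟩
    by_cases hxS : x ∈ S
    · simp [hx, hxS]
    · simp [hxS, hv' x hxS]

open Classical in
theorem exists_rels (S : Set RelVar) (hP : SODefinable L P) :
    SODefinable L fun A _ _ v μ => ∃ μ' : RelVal A, (∀ X ∉ S, μ' X = μ X) ∧ P A v μ' := by
  obtain ⟨ψ, ho, hs⟩ := hP
  obtain ⟨χ, -, -, hχo, hχ⟩ := ψ.exists_exRels (ψ.finite_freeRelVars.inter_of_right S)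
    fun X hX => Formula.order_le_of_mem_freeRelVars ho hX.2
  refine ⟨χ, hχo ho, fun A _ _ v μ => (hχ A v μ).trans ⟨?_, ?_⟩⟩
  · rintro ⟨μ', hμ', h⟩
    exact ⟨μ', fun x hx => hμ' x fun h => hx h.1, (hs A v μ').1 h⟩
  · rintro ⟨μ', hμ', h⟩
    refine ⟨fun X => if X ∈ S ∩ ψ.freeRelVars then μ' X else μ X, fun X hX => if_neg hX,
      (ψ.sat_congr (fun _ _ => rfl) fun X hX => ?_).2 ((hs A v μ').2 h)⟩
    by_cases hXS : X ∈ S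
    · simp [hX, hXS]
    · simp [hXS, hμ' X hXS]

/-- Quantification over `d`-tuples of elements, which are the values of the variables from `m`
to `m + d - 1`. -/
theorem exists_tuple
    {Q : (A : Type u) → [Finite A] → [L.Structure A] → (ℕ → A) → RelVal A → List A → Prop}
    (m d : ℕ) (h : SODefinable L fun A _ _ v μ => Q A v μ ((List.range' m d).map v))
    (hQ : ∀ (A : Type u) [Finite A] [L.Structure A] (v v' : ℕ → A) (μ : RelVal A) (t : List A),
      (∀ x < m, v' x = v x) → Q A v' μ t → Q A v μ t) :
    SODefinable L fun A _ _ v μ => ∃ t : List A, t.length = d ∧ Q A v μ t := by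
  refine (h.exists_elems {x | m ≤ x}).congr fun A _ _ v μ => ⟨?_, ?_⟩
  · rintro ⟨v', hv', h⟩
    exact ⟨_, by simp, hQ A v v' μ _ (fun x hx => hv' x (by simpa using hx)) h⟩
  · rintro ⟨t, rfl, ht⟩
    let v' (x : ℕ) : A := if m ≤ x then t.getD (x - m) (v x) else v x
    have hv' : ∀ x < m, v' x = v x := fun x hx => if_neg (by omega)
    refine ⟨v', fun x hx => hv' x (by simpa using hx), ?_⟩
    have hv't : (List.range' m t.length).map v' = t := by
      refine List.ext_getElem (by simp) fun i h₁ h₂ => ?_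
      simp [v', h₂]
    rw [hv't]
    exact hQ A v' v μ t (fun x hx => (hv' x hx).symm) ht

theorem forall_tuple
    {Q : (A : Type u) → [Finite A] → [L.Structure A] → (ℕ → A) → RelVal A → List A → Prop}
    (m d : ℕ) (h : SODefinable L fun A _ _ v μ => Q A v μ ((List.range' m d).map v))
    (hQ : ∀ (A : Type u) [Finite A] [L.Structure A] (v v' : ℕ → A) (μ : RelVal A) (t : List A),
      (∀ x < m, v' x = v x) → Q A v' μ t → Q A v μ t) :
    SODefinable L fun A _ _ v μ => ∀ t : List A, t.length = d → Q A v μ t :=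
  (exists_tuple (Q := fun A _ _ v μ t => ¬ Q A v μ t) m d h.not
    (fun A _ _ v v' μ t hv => mt (hQ A v' v μ t fun x hx => (hv x hx).symm))).not.congr
    fun A _ _ v μ => by simp

theorem code (b : ℕ) (p xs : List ℕ) :
    SODefinable L fun (A : Type u) _ _ v μ => μ.code b p (xs.map v) := by
  obtain ⟨r, x, rfl⟩ : ∃ (r : ℕ) (x : Fin r → ℕ), xs = List.ofFn x :=
    ⟨_, xs.get, (List.ofFn_get xs).symm⟩
  rcases Nat.eq_zero_or_pos r with rfl | hr
  -- Arities are positive, so a stored code never holds of the empty list.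
  · refine SODefinable.true.not.congr fun A _ _ v μ => ?_
    simp only [not_true_eq_false, false_iff]
    rintro ⟨r, hr, t, h, -⟩
    have := congrArg List.length h
    simp at this
    omega
  · refine ⟨.soAtom (hr := hr) (.so (Nat.pair b (Encodable.encode p))) x, le_rfl,
      fun A _ _ v μ => ?_⟩
    beta_reduce
    rw [List.map_ofFn, RelVal.code_ofFn _ _ _ hr]
    rfl

/-- The equality of coded relations is definable in second order logic. -/
theorem decode_eq {j : ℕ} (τ : RelType j) (d d' b b' : ℕ) (q q' xs ys : List ℕ) :
    SODefinable L fun (A : Type u) _ _ v μ =>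
      ((μ.code b).sub q (xs.map v)).decode d τ = ((μ.code b').sub q' (ys.map v)).decode d' τ := by
  induction τ generalizing d d' b b' q q' xs ys with
  | so r hr =>
    obtain ⟨m, hxs, hys⟩ : ∃ m, (∀ x ∈ xs, x < m) ∧ ∀ y ∈ ys, y < m :=
      ⟨xs.sum + ys.sum + 1,
        fun x hx => by have := List.le_sum_of_mem hx; omega,
        fun y hy => by have := List.le_sum_of_mem hy; omega⟩
    have := forall_tuple (L := L) (Q := fun (A : Type u) _ _ v μ t =>
      (μ.code b (q ++ []) (xs.map v ++ t) ↔ μ.code b' (q' ++ []) (ys.map v ++ t))) m r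
      (by simpa only [← List.map_append] using (code b _ _).iff (code b' _ _))
      (fun _ _ _ v v' μ t hv h => by
        rwa [List.map_congr_of_lt hxs hv, List.map_congr_of_lt hys hv] at h)
    refine this.congr fun A _ _ v μ => ?_
    constructor
    · intro h
      exact Set.ext fun t => h _ (by simp)
    · rintro h t rfl
      have := Set.ext_iff.1 h t.get
      rw [← List.ofFn_get t]
      exact this
  | @ho j w hw ρ ih =>
    -- One inclusion between the decoded relations; the other is the same statement with the two
    -- codes exchanged.
    have key (d d' b b' : ℕ) (q q' xs ys : List ℕ) :
        SODefinable L fun (A : Type u) _ _ v μ => ∀ a : List A, a.length = d →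
          μ.code b q (xs.map v ++ a) → ∃ a' : List A, a'.length = d' ∧
            (μ.code b' q' (ys.map v ++ a') ∧ ∀ k,
              ((μ.code b).sub (q ++ [k.1]) (xs.map v ++ a)).decode d (ρ k) =
              ((μ.code b').sub (q' ++ [k.1]) (ys.map v ++ a')).decode d' (ρ k)) := by
      obtain ⟨m, hxs, hys⟩ : ∃ m, (∀ x ∈ xs, x < m) ∧ ∀ y ∈ ys, y < m :=
        ⟨xs.sum + ys.sum + 1,
          fun x hx => by have := List.le_sum_of_mem hx; omega,
          fun y hy => by have := List.le_sum_of_mem hy; omega⟩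
      refine forall_tuple m d (imp ?_ (exists_tuple (m + d) d' ?_ ?_)) ?_
      · simpa only [← List.map_append] using code b q _
      · simpa only [← List.map_append] using (code b' q' _).and (forall_fin fun k => ih k ..)
      · intro _ _ _ v v' μ t hv h
        rwa [List.map_congr_of_lt (fun x hx => (hxs x hx).trans_le (Nat.le_add_right m d)) hv,
          List.map_congr_of_lt (fun x hx => (hys x hx).trans_le (Nat.le_add_right m d)) hv,
          List.map_congr_of_lt (fun x hx => by simpa using (List.mem_range'_1.1 hx).2) hv] at h
      · intro _ _ _ v v' μ t hv h
        rwa [List.map_congr_of_lt hxs hv, List.map_congr_of_lt hys hv] at h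
    refine ((key d d' b b' q q' xs ys).and (key d' d b' b q' q ys xs)).congr fun A _ _ v μ => ?_
    rw [Code.decode_ho_eq_iff]
    simp only [Code.sub_sub]
    simp only [Code.sub, List.append_nil]

end SODefinable

/-! ### Translation of formulae. -/

/-- Second order logic defines every formula of higher order under the valuations where each
variable has the value coded by the variables that `σ` assigns to it. -/
theorem Formula.soDefinable_decode {L : FirstOrder.Language} (φ : Formula L) (σ : RelVar → ℕ) :
    SODefinable L fun (A : Type u) _ _ v μ => φ.Sat A v (μ.decode σ) := by
  induction φ generalizing σ with
  | eq x y => exact ⟨.eq x y, trivial, fun A _ _ v μ => Iff.rfl⟩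
  | rel R x => exact ⟨.rel R x, trivial, fun A _ _ v μ => Iff.rfl⟩
  | @soAtom r hr X x =>
    refine (SODefinable.code (σ ⟨X⟩) [] (List.ofFn x)).congr fun A _ _ v μ => ?_
    rw [List.map_ofFn]
    rfl
  | @hoAtom j w hw ρ X Y =>
    have := SODefinable.exists_tuple (L := L) (Q := fun (A : Type u) _ _ v μ a =>
      μ.code (σ ⟨X⟩) [] a ∧ ∀ k, ((μ.code (σ ⟨Y k⟩)).sub [] []).decode (Y k).degree (ρ k) =
        ((μ.code (σ ⟨X⟩)).sub [k.1] a).decode X.degree (ρ k)) 0 X.degree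
      ((SODefinable.code _ _ _).and (SODefinable.forall_fin fun k =>
        SODefinable.decode_eq (ρ k) _ _ _ _ _ _ [] _))
      (fun A _ _ v v' μ t _ h => h)
    exact this.congr fun A _ _ v μ => Iff.rfl
  | neg φ ih => exact (ih σ).not
  | and φ ψ ih₁ ih₂ => exact (ih₁ σ).and (ih₂ σ)
  | exElem x φ ih =>
    refine ((ih σ).exists_elems {x}).congr fun A _ _ v μ => ⟨?_, ?_⟩
    · rintro ⟨v', hv', h⟩
      refine ⟨v' x, ?_⟩
      rwa [← Function.eq_update_iff.2 ⟨rfl, hv'⟩]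
    · rintro ⟨a, h⟩
      exact ⟨_, fun y hy => Function.update_of_ne hy _ _, h⟩
  | @exRel j τ X φ ih =>
    classical
    -- A code number not used by any free variable of `φ`, so that changing the code of `X` leaves
    -- the other values intact.
    obtain ⟨b, hb⟩ := (φ.finite_freeRelVars.image σ).exists_notMem
    have hμ {A : Type u} {μ μ' : RelVal A} (h : ∀ Y ∉ codeVars b, μ' Y = μ Y) :
        ∀ Y ∈ φ.freeRelVars, μ'.decode (Function.update σ ⟨X⟩ b) Y =
          Function.update (μ.decode σ) ⟨X⟩ ((μ'.code b).decode X.degree τ) Y := by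
      intro Y hY
      by_cases hYX : Y = ⟨X⟩
      · subst hYX
        simp [RelVal.decode]
      · simp only [RelVal.decode, Function.update_of_ne hYX]
        rw [RelVal.code_congr fun Z hZ => h Z fun hZb => ?_]
        obtain ⟨r, hr, n, rfl⟩ := hZ
        obtain ⟨r', hr', n', h'⟩ := hZb
        generalize hm : Nat.pair (σ Y) n = m at h'
        generalize hm' : Nat.pair b n' = m' at h'
        cases h'
        exact hb ⟨Y, hY, (Nat.pair_eq_pair.1 (hm.trans hm'.symm)).1⟩
    refine ((ih (Function.update σ ⟨X⟩ b)).exists_rels (codeVars b)).congr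
      fun A _ _ v μ => ⟨?_, ?_⟩
    · rintro ⟨μ', hμ', h⟩
      exact ⟨(μ'.code b).decode X.degree τ, (X.inRange_iff _).2 (Code.downwardBounded_decode _ _ _),
        (φ.sat_congr (fun _ _ => rfl) (hμ hμ')).1 h⟩
    · rintro ⟨R, hR, h⟩
      obtain ⟨c, rfl⟩ := Code.exists_decode_eq X.degree τ R ((X.inRange_iff R).1 hR)
      obtain ⟨μ', hμ', hc⟩ := μ.exists_code_eq b c
      refine ⟨μ', hμ', (φ.sat_congr (fun _ _ => rfl) (hμ hμ')).2 ?_⟩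
      rwa [Code.decode_congr X.one_le_degree τ hc]

/-! ### Adjusting the free variables. -/

namespace Formula

variable {L : FirstOrder.Language}

/-- Free variables can be added to a formula. -/
theorem exists_freeVars_union (ψ : Formula L) {S : Set ℕ} (hS : S.Finite) :
    ∃ χ : Formula L, χ.freeVars = ψ.freeVars ∪ S ∧ χ.freeRelVars = ψ.freeRelVars ∧
      (∀ i, ψ.OrderLE i → χ.OrderLE i) ∧
      ∀ (A : Type*) [L.Structure A] (v : ℕ → A) (ν : (X : RelVar) → HORel A X.type),
        χ.Sat A v ν ↔ ψ.Sat A v ν := by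
  induction S, hS using Set.Finite.induction_on with
  | empty => exact ⟨ψ, by simp, rfl, fun _ h => h, fun A _ v ν => Iff.rfl⟩
  | @insert x S _ _ ih =>
    obtain ⟨χ, hfv, hfr, ho, hs⟩ := ih
    refine ⟨.and χ (.eq x x), ?_, ?_, fun i h => ⟨ho i h, trivial⟩, fun A _ v ν => ?_⟩
    · ext y
      simp only [freeVars, hfv, Set.mem_union, Set.mem_insert_iff, Set.mem_singleton_iff]
      tauto
    · simp [freeRelVars, hfr]
    · simp [Sat, hs]

end Formula

end HigherOrder

theorem mainTheorem2 (L : FirstOrder.Language) [L.IsRelational] (i : ℕ) (hi : 3 ≤ i)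
    (φ : HigherOrder.Formula L) (hφ : φ.IsHOP i) :
    ∃ ψ : HigherOrder.Formula L, ψ.IsSO ∧ ψ.freeVars = φ.freeVars ∧
      ∀ (A : Type*) [Finite A] [L.Structure A] (v : ℕ → A)
        (ν : (X : HigherOrder.RelVar) → HigherOrder.HORel A X.type),
        φ.Sat A v ν ↔ ψ.Sat A v ν := by
  obtain ⟨ψ, ho, hs⟩ := φ.soDefinable_decode fun _ => 0
  have hφψ (A : Type _) [Finite A] [L.Structure A] (v : ℕ → A) (ν μ : HigherOrder.RelVal A) :
      φ.Sat A v ν ↔ ψ.Sat A v μ :=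
    (φ.sat_congr (fun _ _ => rfl) fun X hX => by simp [hφ.2] at hX).trans (hs A v μ).symm
  -- The truth of `ψ` depends neither on the relation variables nor on elements not free in `φ`, so
  -- binding these existentially changes nothing.
  obtain ⟨ψ₁, hv₁, hr₁, ho₁, hs₁⟩ := ψ.exists_exRels ψ.finite_freeRelVars
    fun X hX => HigherOrder.Formula.order_le_of_mem_freeRelVars ho hX
  obtain ⟨ψ₂, hv₂, hr₂, ho₂, hs₂⟩ := ψ₁.exists_exElems (ψ₁.finite_freeVars.sdiff (t := φ.freeVars))
  obtain ⟨ψ₃, hv₃, hr₃, ho₃, hs₃⟩ := ψ₂.exists_freeVars_union φ.finite_freeVars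
  refine ⟨ψ₃, ⟨ho₃ 2 (ho₂ 2 (ho₁ ho)), by simp [hr₃, hr₂, hr₁]⟩, ?_, fun A _ _ v ν => ?_⟩
  · rw [hv₃, hv₂, Set.union_eq_right]
    intro x hx
    by_contra h
    exact hx.2 ⟨hx.1, h⟩
  · rw [hs₃, hs₂]
    constructor
    · intro h
      exact ⟨v, fun _ _ => rfl, (hs₁ A v ν).2 ⟨ν, fun _ _ => rfl, (hφψ A v ν ν).1 h⟩⟩
    · rintro ⟨v', hv', h⟩
      obtain ⟨ν', -, h⟩ := (hs₁ A v' ν).1 h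
      exact (φ.sat_congr (fun x hx => hv' x fun h => h.2 hx) fun _ _ => rfl).1
        ((hφψ A v' ν ν').2 h)
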